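/- Let $H\neq\{0\}$ be a separable complex Hilbert space and $\Omega\subset\mathbb{R}^n$ a bounded domain. Let the real continuous functions on $\overline\Omega$ act on $H$ as bounded operators through a unital $*$-representation of $C(\overline\Omega,\mathbb{R})$ (for example by multiplication on $H=L^2(\Omega)$; or, if only constant functions matter, by scalars on any $H$); write $b$ also for the operator by which $b\in C(\overline\Omega,\mathbb{R})$ acts. Let $N\ge 1$, $a_j>0$ $(1\le j\le N)$, $0<b_1<\dots<b_N$, and put $$\mathcal{D}=\mathbb{C}\setminus\{-b_1,\dots,-b_N\},\qquad \hat K(\lambda)=\sum_{j=1}^N\frac{a_jb_j}{\lambda+b_j}.$$ Let $T_a$ be a positive self-adjoint operator in $H$ with compact inverse, let $b\in C(\overline\Omega,\mathbb{R})$, and let $T_b$ be a self-adjoint operator with $T_b=bT_a$ on $\operatorname{dom}T_a$. Let $0\le b_{\min}\le b(x)\le b_{\max}$ for $x\in\overline\Omega$, where $b_{\max}>0$ and $b_{\max}\sum_{j=1}^N a_j<1$. For $\lambda\in\mathcal{D}$ let $T(\lambda)$ be the closure of $\lambda^2+T_a-\hat K(\lambda)T_b$, defined on $\operatorname{dom}T_a\cap\operatorname{dom}T_b$,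 and let $\sigma_{\rm ess}(T)$ be the set of all $\lambda\in\mathcal{D}$ for which $T(\lambda)$ is not a Fredholm operator. Let $W(T_a)=\{(T_au,u):u\in\operatorname{dom}T_a,\ \|u\|=1\}$, $W_{\min}(T_a)=\inf W(T_a)$, and $$W_{\alpha,\beta}(T)=\overline{\{\lambda\in\mathcal{D}:\ \lambda^2+\alpha-\beta\hat K(\lambda)=0\ \text{for some}\ \alpha\in W(T_a),\ \beta\in[b_{\min}\alpha,b_{\max}\alpha]\}},$$ the closure being taken in $\mathbb{C}$. For $\hat b\in[b_{\min},b_{\max}]$ let $$g(\lambda)=-\frac{\lambda^2}{1-\hat b\hat K(\lambda)},$$ let $S$ be the set of all $\lambda\in\mathbb{R}\cap\mathcal{D}$ such that, for some $\hat b\in[b_{\min},b_{\max}]$, $1-\hat b\hat K(\lambda)\ne0$ and $g(\lambda)\ge W_{\min}(T_a)$, and let $c_0=\inf S$, $c_1=\sup S$. Then $S$ is non-empty and bounded (so that $c_0,c_1$ are real numbers), and $$\sigma_{\rm ess}(T)\subset W_{\alpha,\beta}(T)\cap\mathbb{R}\subset[c_0,c_1]\subset[-b_N,0].$$ If $b_{\min}>0$,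 then moreover $c_0=\min S$ and $[c_0,c_1]\subset(-b_N,0]$. Finally, $W_{\alpha,\beta}(T)$ is symmetric with respect to the real axis. -/

import Mathlib

noncomputable section

namespace GurtinPipkin

/-! ### Unbounded operators in a complex Hilbert space -/

section Operators

variable {H : Type*} [NormedAddCommGroup H] [InnerProductSpace ℂ H]

/-- `z · id`, as an everywhere defined operator. -/
def scalarOp (H : Type*) [NormedAddCommGroup H] [InnerProductSpace ℂ H] (z : ℂ) : H →ₗ.[ℂ] H :=
  (z • (LinearMap.id : H →ₗ[ℂ] H)).toPMap ⊤

/-- Positivity: `(A u, u) > 0` for every nonzero `u` in the domain. -/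
def IsPositiveOp (A : H →ₗ.[ℂ] H) : Prop :=
  ∀ u : A.domain, (u : H) ≠ 0 → 0 < (inner ℂ (u : H) (A u)).re

/-- `A` has an everywhere defined compact inverse. -/
def HasCompactInverse (A : H →ₗ.[ℂ] H) : Prop :=
  ∃ R : H →L[ℂ] H, IsCompactOperator R ∧
    (∀ x : H, ∃ h : R x ∈ A.domain, A ⟨R x, h⟩ = x) ∧
    (∀ u : A.domain, R (A u) = u)

/-- A (closed) operator is Fredholm if its kernel is finite dimensional and its range is closed
and of finite codimension. -/
def IsFredholmOp (A : H →ₗ.[ℂ] H) : Prop :=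
  FiniteDimensional ℂ (LinearMap.ker A.toFun) ∧
    IsClosed (LinearMap.range A.toFun : Set H) ∧
    FiniteDimensional ℂ (H ⧸ LinearMap.range A.toFun)

/-- The essential spectrum of a closed operator: all `z` such that `A - z` is not Fredholm. -/
def essSpectrum (A : H →ₗ.[ℂ] H) : Set ℂ :=
  {z | ¬ IsFredholmOp (A - scalarOp H z)}

/-- The numerical range `{(A u, u) : u ∈ dom A, ‖u‖ = 1}` of a symmetric operator, as a set of
real numbers. -/
def numRange (A : H →ₗ.[ℂ] H) : Set ℝ :=
  {α | ∃ u : A.domain, ‖(u : H)‖ = 1 ∧ inner ℂ (u : H) (A u) = (α : ℂ)}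

/-- `W_min(A)`, the lower end of the numerical range. -/
def numRangeMin (A : H →ₗ.[ℂ] H) : ℝ := sInf (numRange A)

end Operators

/-! ### The kernel and the operator function -/

variable {N : ℕ}

/-- The maximal domain `ℂ \ {-b₁, …, -b_N}`. -/
def symbolDomain (b : Fin N → ℝ) : Set ℂ := {z | ∀ j, z ≠ -(b j : ℂ)}

/-- `K̂(z) = ∑ⱼ aⱼ bⱼ / (z + bⱼ)`. -/
def Khat (a b : Fin N → ℝ) (z : ℂ) : ℂ := ∑ j, (a j * b j : ℂ) / (z + b j)

section Symbol

variable {H : Type*} [NormedAddCommGroup H] [InnerProductSpace ℂ H]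

/-- The closed operator function `T(z) = z² + T_a - K̂(z) T_b`: the closure of this sum on its
natural domain `dom T_a ∩ dom T_b`. (If `T_b = β T_a` with a constant `β`, then its domain is `H`
when `1 - β K̂(z) = 0`, and `dom T_a` otherwise.) -/
def symbolOp (a b : Fin N → ℝ) (Ta Tb : H →ₗ.[ℂ] H) (z : ℂ) : H →ₗ.[ℂ] H :=
  (scalarOp H (z ^ 2) + Ta - Khat a b z • Tb).closure

/-- The essential spectrum of the operator function `T`. -/
def essSpectrumSymbol (a b : Fin N → ℝ) (Ta Tb : H →ₗ.[ℂ] H) : Set ℂ :=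
  {z | z ∈ symbolDomain b ∧ (0 : ℂ) ∈ essSpectrum (symbolOp a b Ta Tb z)}

/-- The enclosure `W_{α,β}(T)`; the closure is taken in `ℂ`. -/
def enclosure (a b : Fin N → ℝ) (bmin bmax : ℝ) (Ta : H →ₗ.[ℂ] H) : Set ℂ :=
  closure {z | z ∈ symbolDomain b ∧ ∃ α ∈ numRange Ta, ∃ β ∈ Set.Icc (bmin * α) (bmax * α),
    z ^ 2 + (α : ℂ) - (β : ℂ) * Khat a b z = 0}

end Symbol

/-- The denominator `1 - b̂ ∑ⱼ aⱼ bⱼ / (x + bⱼ)` of `g`, for real `x`. -/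
def gDenom (a b : Fin N → ℝ) (bhat x : ℝ) : ℝ := 1 - bhat * ∑ j, a j * b j / (x + b j)

/-- `g(x) = -x² / (1 - b̂ ∑ⱼ aⱼ bⱼ / (x + bⱼ))`. -/
def g (a b : Fin N → ℝ) (bhat x : ℝ) : ℝ := -x ^ 2 / gDenom a b bhat x

section Constants

variable {H : Type*} [NormedAddCommGroup H] [InnerProductSpace ℂ H]

/-- The set of all real `x` at which `g` is defined and `g(x) ≥ W_min(T_a)` for some
`b̂ ∈ [b_min, b_max]`. -/
def gSet (a b : Fin N → ℝ) (bmin bmax : ℝ) (Ta : H →ₗ.[ℂ] H) : Set ℝ :=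
  {x | (∀ j, x ≠ -b j) ∧
    ∃ bhat ∈ Set.Icc bmin bmax, gDenom a b bhat x ≠ 0 ∧ numRangeMin Ta ≤ g a b bhat x}

/-- The constant `c₀`. -/
def c0 (a b : Fin N → ℝ) (bmin bmax : ℝ) (Ta : H →ₗ.[ℂ] H) : ℝ := sInf (gSet a b bmin bmax Ta)

/-- The constant `c₁`. It is a supremum: `g` tends to `+∞` at the upper end of the set, which is a
zero of the denominator of `g` and so does not belong to the set. -/
def c1 (a b : Fin N → ℝ) (bmin bmax : ℝ) (Ta : H →ₗ.[ℂ] H) : ℝ := sSup (gSet a b bmin bmax Ta)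

end Constants

end GurtinPipkin

end

section

open Filter Topology Set

namespace GurtinPipkin

variable {N : ℕ}

/-! ### The kernel on the real line -/

/-! Let `R` be the inverse of `Ta` and `B` the operator `ρ β`. Then `T(z) R = (1 - K̂(z) B) + z² R`
is a compact perturbation of `1 - K̂(z) B`, and `B` is self-adjoint with spectrum in `[bmin, bmax]`.
So if `T(z)` is not Fredholm, then `r K̂(z) = 1` for some `r` in that interval
(`isFredholmOp_symbolOp`, `isUnit_one_sub_smul`). This makes `K̂(z)` real, hence `z` real.
Non-Fredholmness also forces `dim H = ∞`, so the numerical range of `Ta` is unbounded. As `α → ∞`,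
real roots of `y² + α = r α K̂(y)` approach `z` (`mem_closure_real_solutions`), so `z` is in the
enclosure.

For the second inclusion, divide the equation of the enclosure by `α` and put `t = 1/α`, `s = β/α`:
`z² t + 1 = s K̂(z)`. Admitting `t = 0` makes the parameter range compact, so limits of solutions
are solutions or, if `bmin = 0`, poles. A real solution with `t > 0` lies in the set defined by `g`;
one with `t = 0` is a zero of the denominator of `g`, where `g → +∞` from the left; poles are limits
of that set from the right when `bmin = 0`. Hence real points of the enclosure lie in the closure of
the set (`mem_closure_gLevelSet`), and so between its infimum and supremum. -/

/-- The restriction of `K̂` to the real line. -/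
noncomputable def realKernel (a b : Fin N → ℝ) (x : ℝ) : ℝ := ∑ j, a j * b j / (x + b j)

lemma Khat_ofReal (a b : Fin N → ℝ) (x : ℝ) : Khat a b x = (realKernel a b x : ℂ) := by
  simp [Khat, realKernel]

lemma Khat_conj (a b : Fin N → ℝ) (z : ℂ) :
    Khat a b ((starRingEnd ℂ) z) = (starRingEnd ℂ) (Khat a b z) := by
  simp [Khat, map_sum, map_div₀]

lemma ofReal_mem_symbolDomain {b : Fin N → ℝ} {x : ℝ} :
    (x : ℂ) ∈ symbolDomain b ↔ ∀ j, x ≠ -b j := by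
  simp only [symbolDomain, mem_ofPred_eq, ne_eq]
  exact forall_congr' fun j => by norm_cast

lemma add_ne_zero_of_mem_symbolDomain {b : Fin N → ℝ} {z : ℂ} (hz : z ∈ symbolDomain b)
    (j : Fin N) : z + b j ≠ 0 := fun h => hz j (eq_neg_of_add_eq_zero_left h)

lemma continuousAt_Khat (a : Fin N → ℝ) {b : Fin N → ℝ} {z : ℂ} (hz : z ∈ symbolDomain b) :
    ContinuousAt (Khat a b) z := by
  unfold Khat
  refine tendsto_finsetSum _ fun j _ => ?_
  exact (continuousAt_const.div (continuousAt_id.add continuousAt_const)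
    (add_ne_zero_of_mem_symbolDomain hz j))

lemma continuousAt_realKernel (a : Fin N → ℝ) {b : Fin N → ℝ} {x : ℝ} (hx : ∀ j, x ≠ -b j) :
    ContinuousAt (realKernel a b) x := by
  unfold realKernel
  refine tendsto_finsetSum _ fun j _ => ?_
  exact (continuousAt_const.div (continuousAt_id.add continuousAt_const)
    (fun h => hx j (eq_neg_of_add_eq_zero_left h)))

lemma eventually_ne_pole {b : Fin N → ℝ} {x : ℝ} (hx : ∀ j, x ≠ -b j) :
    ∀ᶠ y in 𝓝 x, ∀ j, y ≠ -b j :=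
  eventually_all.2 fun j => eventually_ne_nhds (hx j)

/-- `K̂` is real only on the real line. -/
lemma im_eq_zero_of_Khat_im_eq_zero (hN : 0 < N) {a b : Fin N → ℝ} (ha : ∀ j, 0 < a j)
    (hb : ∀ j, 0 < b j) {z : ℂ} (hz : z ∈ symbolDomain b) (h : (Khat a b z).im = 0) :
    z.im = 0 := by
  -- Each summand has imaginary part opposite in sign to `z.im`, so nothing can cancel off the real
  -- line.
  have key : (Khat a b z).im = -(z.im * ∑ j, a j * b j / Complex.normSq (z + b j)) := by
    rw [Khat, Complex.im_sum, Finset.mul_sum, ← Finset.sum_neg_distrib]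
    refine Finset.sum_congr rfl fun j _ => ?_
    rw [Complex.div_im]
    simp
    ring
  have hpos : 0 < ∑ j, a j * b j / Complex.normSq (z + b j) := by
    have : Nonempty (Fin N) := ⟨⟨0, hN⟩⟩
    refine Finset.sum_pos (fun j _ => ?_) Finset.univ_nonempty
    exact div_pos (mul_pos (ha j) (hb j))
      (Complex.normSq_pos.2 (add_ne_zero_of_mem_symbolDomain hz j))
  rw [key, neg_eq_zero, mul_eq_zero] at h
  exact h.resolve_right hpos.ne'

/-- `K̂` is strictly decreasing between its poles. -/
lemma realKernel_lt (hN : 0 < N) {a b : Fin N → ℝ} (ha : ∀ j, 0 < a j)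
    (hb : ∀ j, 0 < b j) {x y : ℝ} (hxy : x < y) (h : ∀ j, 0 < (x + b j) * (y + b j)) :
    realKernel a b y < realKernel a b x := by
  have : Nonempty (Fin N) := ⟨⟨0, hN⟩⟩
  refine Finset.sum_lt_sum_of_nonempty Finset.univ_nonempty fun j _ => ?_
  have h1 : x + b j ≠ 0 := left_ne_zero_of_mul (h j).ne'
  have h2 : y + b j ≠ 0 := right_ne_zero_of_mul (h j).ne'
  have : a j * b j / (x + b j) - a j * b j / (y + b j)
      = a j * b j * (y - x) / ((x + b j) * (y + b j)) := by
    field_simp; ring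
  have h3 : 0 < a j * b j * (y - x) / ((x + b j) * (y + b j)) :=
    div_pos (mul_pos (mul_pos (ha j) (hb j)) (sub_pos.2 hxy)) (h j)
  linarith

lemma eventually_same_side {b : Fin N → ℝ} {x : ℝ} (hx : ∀ j, x ≠ -b j) :
    ∀ᶠ y in 𝓝 x, ∀ j, 0 < (y + b j) * (x + b j) := by
  refine eventually_all.2 fun j => ?_
  have hc : ContinuousAt (fun y : ℝ => (y + b j) * (x + b j)) x := by fun_prop
  have h0 : x + b j ≠ 0 := fun h => hx j (eq_neg_of_add_eq_zero_left h)
  exact hc.eventually (lt_mem_nhds (mul_self_pos.2 h0))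

lemma eventually_realKernel_gt (hN : 0 < N) {a b : Fin N → ℝ} (ha : ∀ j, 0 < a j)
    (hb : ∀ j, 0 < b j) {x : ℝ} (hx : ∀ j, x ≠ -b j) :
    ∀ᶠ y in 𝓝[<] x, realKernel a b x < realKernel a b y := by
  filter_upwards [self_mem_nhdsWithin, nhdsWithin_le_nhds (eventually_same_side hx)] with y hy h
  exact realKernel_lt hN ha hb hy h

lemma eventually_realKernel_lt (hN : 0 < N) {a b : Fin N → ℝ} (ha : ∀ j, 0 < a j)
    (hb : ∀ j, 0 < b j) {x : ℝ} (hx : ∀ j, x ≠ -b j) :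
    ∀ᶠ y in 𝓝[>] x, realKernel a b y < realKernel a b x := by
  filter_upwards [self_mem_nhdsWithin, nhdsWithin_le_nhds (eventually_same_side hx)] with y hy h
  exact realKernel_lt hN ha hb hy fun j => by rw [mul_comm]; exact h j

lemma tendsto_realKernel_pole {a b : Fin N → ℝ} (ha : ∀ j, 0 < a j) (hb : ∀ j, 0 < b j)
    (hinj : Function.Injective b) (i : Fin N) :
    Tendsto (realKernel a b) (𝓝[>] (-b i)) atTop := by
  have h1 : Tendsto (fun x : ℝ => ∑ j ∈ Finset.univ.erase i, a j * b j / (x + b j))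
      (𝓝[>] (-b i)) (𝓝 (∑ j ∈ Finset.univ.erase i, a j * b j / (-b i + b j))) := by
    refine tendsto_finsetSum _ fun j hj => ?_
    have hne : -b i + b j ≠ 0 := fun h =>
      (Finset.ne_of_mem_erase hj) (hinj (by linarith))
    have : ContinuousAt (fun x : ℝ => a j * b j / (x + b j)) (-b i) :=
      continuousAt_const.div (continuousAt_id.add continuousAt_const) hne
    exact this.tendsto.mono_left nhdsWithin_le_nhds
  have h2 : Tendsto (fun x : ℝ => a i * b i / (x + b i)) (𝓝[>] (-b i)) atTop := by
    have h3 : Tendsto (fun x : ℝ => x + b i) (𝓝[>] (-b i)) (𝓝[>] 0) := by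
      refine tendsto_nhdsWithin_iff.2 ⟨?_, ?_⟩
      · have : ContinuousAt (fun x : ℝ => x + b i) (-b i) := by fun_prop
        have := this.tendsto
        rw [neg_add_cancel] at this
        exact this.mono_left nhdsWithin_le_nhds
      · filter_upwards [self_mem_nhdsWithin] with x hx
        have : -b i < x := hx
        simp only [mem_Ioi]; linarith
    simp only [div_eq_mul_inv]
    exact (tendsto_inv_nhdsGT_zero.comp h3).const_mul_atTop (mul_pos (ha i) (hb i))
  refine (h2.atTop_add h1).congr fun x => ?_
  rw [realKernel, ← Finset.add_sum_erase _ _ (Finset.mem_univ i)]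

lemma tendsto_norm_Khat_pole {a b : Fin N → ℝ} (ha : ∀ j, 0 < a j) (hb : ∀ j, 0 < b j)
    (hinj : Function.Injective b) (i : Fin N) :
    Tendsto (fun z => ‖Khat a b z‖) (𝓝[≠] (-(b i : ℂ))) atTop := by
  have h1 : Tendsto (fun z : ℂ => ∑ j ∈ Finset.univ.erase i, (a j * b j : ℂ) / (z + b j))
      (𝓝[≠] (-(b i : ℂ)))
      (𝓝 (∑ j ∈ Finset.univ.erase i, (a j * b j : ℂ) / (-(b i : ℂ) + b j))) := by
    refine tendsto_finsetSum _ fun j hj => ?_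
    have hne : -(b i : ℂ) + b j ≠ 0 := fun h =>
      (Finset.ne_of_mem_erase hj) (hinj (by
        have : (b j : ℂ) = b i := by linear_combination h
        exact_mod_cast this))
    have : ContinuousAt (fun z : ℂ => (a j * b j : ℂ) / (z + b j)) (-(b i : ℂ)) :=
      continuousAt_const.div (continuousAt_id.add continuousAt_const) hne
    exact this.tendsto.mono_left nhdsWithin_le_nhds
  have h2 : Tendsto (fun z : ℂ => (a i * b i : ℂ) / (z + b i)) (𝓝[≠] (-(b i : ℂ)))
      (Bornology.cobounded ℂ) := by
    have h3 : Tendsto (fun z : ℂ => z + b i) (𝓝[≠] (-(b i : ℂ))) (𝓝[≠] 0) := by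
      refine tendsto_nhdsWithin_iff.2 ⟨?_, ?_⟩
      · have : ContinuousAt (fun z : ℂ => z + b i) (-(b i : ℂ)) := by fun_prop
        have := this.tendsto
        rw [neg_add_cancel] at this
        exact this.mono_left nhdsWithin_le_nhds
      · filter_upwards [self_mem_nhdsWithin] with z hz h
        exact hz (eq_neg_of_add_eq_zero_left h)
    have hne : (a i * b i : ℂ) ≠ 0 := by
      exact_mod_cast (mul_pos (ha i) (hb i)).ne'
    simp only [div_eq_mul_inv]
    exact (tendsto_mul_left_cobounded hne).comp (tendsto_inv₀_nhdsNE_zero.comp h3)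
  -- Reverse triangle inequality: the singular term minus the convergent remainder.
  refine tendsto_atTop_mono (fun z => ?_)
    ((tendsto_norm_cobounded_atTop.comp h2).atTop_add h1.norm.neg)
  rw [Khat, ← Finset.add_sum_erase _ _ (Finset.mem_univ i), ← sub_eq_add_neg]
  exact norm_sub_le_norm_add _ _

/-! ### The level set of `g` and its complex companion -/

/-- The set `gSet` with the number `W` in place of `W_min(T_a)`. -/
def gLevelSet (a b : Fin N → ℝ) (bmin bmax W : ℝ) : Set ℝ :=
  {x | (∀ j, x ≠ -b j) ∧
    ∃ bhat ∈ Set.Icc bmin bmax, gDenom a b bhat x ≠ 0 ∧ W ≤ g a b bhat x}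

/-- The solutions of `z² t + 1 = s K̂(z)` with `t ∈ [0, 1/W]` and `s ∈ [b_min, b_max]`. For `t > 0`
this is the equation of the enclosure with `α = 1/t` and `β = s/t`. -/
def pencilSet (a b : Fin N → ℝ) (bmin bmax W : ℝ) : Set ℂ :=
  {z | z ∈ symbolDomain b ∧ ∃ t ∈ Icc 0 W⁻¹, ∃ s ∈ Icc bmin bmax,
    z ^ 2 * (t : ℂ) + 1 = (s : ℂ) * Khat a b z}

variable {a b : Fin N → ℝ} {bmin bmax W : ℝ}

/-- Since `W > 0` and the numerator of `g` is nonpositive, `g ≥ W` forces a negative denominator,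
which can then be cleared with a known sign. -/
lemma mem_gLevelSet_iff (hW : 0 < W) {x : ℝ} :
    x ∈ gLevelSet a b bmin bmax W ↔ (∀ j, x ≠ -b j) ∧ ∃ s ∈ Icc bmin bmax,
      1 < s * realKernel a b x ∧ W * (s * realKernel a b x - 1) ≤ x ^ 2 := by
  refine and_congr_right fun _ => exists_congr fun s => and_congr_right fun _ => ?_
  have hd : gDenom a b s x = 1 - s * realKernel a b x := rfl
  rw [g, hd]
  set k := s * realKernel a b x
  constructor
  · rintro ⟨h0, h1⟩
    have hlt : 1 < k := by
      by_contra hk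
      have hpos : 0 < 1 - k := lt_of_le_of_ne (by linarith) (Ne.symm h0)
      have := div_nonpos_of_nonpos_of_nonneg (neg_nonpos.2 (sq_nonneg x)) hpos.le
      linarith
    refine ⟨hlt, ?_⟩
    rw [← neg_div_neg_eq, neg_neg, neg_sub, le_div_iff₀ (by linarith)] at h1
    exact h1
  · rintro ⟨h1, h2⟩
    refine ⟨by linarith, ?_⟩
    rw [← neg_div_neg_eq, neg_neg, neg_sub, le_div_iff₀ (by linarith)]
    exact h2

/-- A point of the level set is a real point of the companion set. -/
lemma ofReal_mem_pencilSet (hW : 0 < W) {x : ℝ} (hx : x ∈ gLevelSet a b bmin bmax W) :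
    (x : ℂ) ∈ pencilSet a b bmin bmax W := by
  obtain ⟨hD, s, hs, h1, h2⟩ := (mem_gLevelSet_iff hW).1 hx
  have hx0 : 0 < x ^ 2 := lt_of_lt_of_le (mul_pos hW (by linarith)) h2
  -- This `t` solves the pencil equation; the bound `t ≤ 1/W` is exactly `g ≥ W`.
  refine ⟨ofReal_mem_symbolDomain.2 hD, (s * realKernel a b x - 1) / x ^ 2, ⟨?_, ?_⟩, s, hs, ?_⟩
  · exact div_nonneg (by linarith) hx0.le
  · rw [div_le_iff₀ hx0, inv_mul_eq_div, le_div_iff₀ hW]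
    linarith
  · rw [Khat_ofReal]
    norm_cast
    rw [mul_div_cancel₀ _ hx0.ne', sub_add_cancel]

/-- For nonnegative `x` the denominator of `g` is positive. -/
lemma mul_realKernel_lt_one (ha : ∀ j, 0 < a j) (hb : ∀ j, 0 < b j)
    (hbmax : 0 < bmax) (hsum : bmax * ∑ j, a j < 1) {s : ℝ} (hs : s ≤ bmax) {x : ℝ} (hx : 0 ≤ x) :
    s * realKernel a b x < 1 := by
  have h0 : 0 ≤ realKernel a b x := Finset.sum_nonneg fun j _ =>
    div_nonneg (mul_pos (ha j) (hb j)).le (add_nonneg hx (hb j).le)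
  have h1 : realKernel a b x ≤ ∑ j, a j := by
    refine Finset.sum_le_sum fun j _ => ?_
    rw [div_le_iff₀ (by linarith [hb j])]
    nlinarith [ha j, mul_nonneg (ha j).le hx]
  calc s * realKernel a b x ≤ bmax * realKernel a b x := by gcongr
    _ ≤ bmax * ∑ j, a j := by gcongr
    _ < 1 := hsum

lemma lt_zero_of_one_le (ha : ∀ j, 0 < a j) (hb : ∀ j, 0 < b j)
    (hbmax : 0 < bmax) (hsum : bmax * ∑ j, a j < 1) {s : ℝ} (hs : s ≤ bmax) {x : ℝ}
    (h : 1 ≤ s * realKernel a b x) : x < 0 := by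
  by_contra hx
  exact absurd (mul_realKernel_lt_one ha hb hbmax hsum hs (not_lt.1 hx)) (not_lt.2 h)

/-- At a zero of its denominator, `g` tends to `+∞` from the left. -/
lemma eventually_mem_gLevelSet (hN : 0 < N) (ha : ∀ j, 0 < a j) (hb : ∀ j, 0 < b j)
    (hbmin : 0 ≤ bmin) {x s : ℝ} (hD : ∀ j, x ≠ -b j) (hs : s ∈ Icc bmin bmax) (hx : x ≠ 0)
    (hW : 0 < W) (h : s * realKernel a b x = 1) :
    ∀ᶠ y in 𝓝[<] x, y ∈ gLevelSet a b bmin bmax W := by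
  have hs0 : 0 < s := lt_of_le_of_ne (hbmin.trans hs.1) (by rintro rfl; simp at h)
  have hc : ContinuousAt (fun y => y ^ 2 - W * (s * realKernel a b y - 1)) x :=
    (continuousAt_id.pow 2).sub (continuousAt_const.mul
      ((continuousAt_const.mul (continuousAt_realKernel a hD)).sub continuousAt_const))
  have hpos : 0 < x ^ 2 - W * (s * realKernel a b x - 1) := by
    rw [h, sub_self, mul_zero, sub_zero]; positivity
  -- Left of `x` the decreasing kernel gives `s K̂ > 1`; the other inequality has slack `x² > 0` at
  -- `x` and persists by continuity.
  filter_upwards [eventually_realKernel_gt hN ha hb hD,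
    nhdsWithin_le_nhds (eventually_ne_pole hD),
    nhdsWithin_le_nhds (hc.eventually (lt_mem_nhds hpos))] with y h1 h2 h3
  refine (mem_gLevelSet_iff hW).2 ⟨h2, s, hs, ?_, by linarith⟩
  rw [← h]
  exact mul_lt_mul_of_pos_left h1 hs0

/-- If `b_min = 0`, the level set accumulates at each pole. -/
lemma eventually_mem_gLevelSet_pole (ha : ∀ j, 0 < a j) (hb : ∀ j, 0 < b j)
    (hinj : Function.Injective b) (hbmax : 0 < bmax) (hW : 0 < W) (i : Fin N) :
    ∀ᶠ y in 𝓝[>] (-b i), y ∈ gLevelSet a b 0 bmax W := by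
  -- With `s = (1 + ε) / K̂(y)` the excess `s K̂(y) - 1` is the constant `ε`, and `W ε = bᵢ²/2 < y²`
  -- near the pole. As `K̂(y) → ∞`, this `s` drops below `bmax`.
  set ε := b i ^ 2 / (2 * W) with hε
  have hε0 : 0 < ε := div_pos (pow_pos (hb i) 2) (by linarith)
  have hWε : W * ε = b i ^ 2 / 2 := by rw [hε]; field_simp
  have hne : ∀ᶠ y in 𝓝[>] (-b i), ∀ j, y ≠ -b j := by
    refine eventually_all.2 fun j => ?_
    by_cases hj : j = i
    · subst hj
      filter_upwards [self_mem_nhdsWithin] with y hy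
      exact ne_of_gt hy
    · refine nhdsWithin_le_nhds (eventually_ne_nhds fun h => hj (hinj ?_))
      linarith
  have hc : ContinuousAt (fun y : ℝ => y ^ 2) (-b i) := by fun_prop
  have hlt : b i ^ 2 / 2 < (-b i) ^ 2 := by nlinarith [pow_pos (hb i) 2]
  filter_upwards [hne, nhdsWithin_le_nhds (hc.eventually (lt_mem_nhds hlt)),
    (tendsto_realKernel_pole ha hb hinj i).eventually_ge_atTop ((1 + ε) / bmax)] with y h1 h2 h3
  have hk : 0 < realKernel a b y := lt_of_lt_of_le (div_pos (by linarith) hbmax) h3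
  refine (mem_gLevelSet_iff hW).2 ⟨h1, (1 + ε) / realKernel a b y, ⟨?_, ?_⟩, ?_, ?_⟩
  · exact div_nonneg (by linarith) hk.le
  · rw [div_le_iff₀ hk]
    rw [div_le_iff₀ hbmax] at h3
    linarith
  · rw [div_mul_cancel₀ _ hk.ne']; linarith
  · rw [div_mul_cancel₀ _ hk.ne', add_sub_cancel_left, hWε]; exact h2.le

/-- A real point of the companion set lies in the level set or is a limit of points of it
from the left. -/
lemma mem_or_eventually_of_ofReal_mem_pencilSet (hN : 0 < N) (ha : ∀ j, 0 < a j)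
    (hb : ∀ j, 0 < b j) (hbmin : 0 ≤ bmin) (hbmax : 0 < bmax) (hsum : bmax * ∑ j, a j < 1)
    (hW : 0 < W) {x : ℝ} (hx : (x : ℂ) ∈ pencilSet a b bmin bmax W) :
    x ∈ gLevelSet a b bmin bmax W ∨ ∀ᶠ y in 𝓝[<] x, y ∈ gLevelSet a b bmin bmax W := by
  obtain ⟨hD, t, ht, s, hs, h⟩ := hx
  rw [ofReal_mem_symbolDomain] at hD
  rw [Khat_ofReal] at h
  norm_cast at h
  have h1 : 1 ≤ s * realKernel a b x := by
    rw [← h]; nlinarith [mul_nonneg (sq_nonneg x) ht.1]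
  have hx0 := lt_zero_of_one_le ha hb hbmax hsum hs.2 h1
  -- Since `x ≠ 0`, equality means `t = 0`: the denominator of `g` vanishes.
  rcases h1.eq_or_lt with h2 | h2
  · exact .inr (eventually_mem_gLevelSet hN ha hb hbmin hD hs hx0.ne hW h2.symm)
  · refine .inl ((mem_gLevelSet_iff hW).2 ⟨hD, s, hs, h2, ?_⟩)
    rw [← h, add_sub_cancel_right]
    calc W * (x ^ 2 * t) ≤ W * (x ^ 2 * W⁻¹) := by gcongr; exact ht.2
      _ = x ^ 2 := by field_simp

/-- The companion set is closed up to the poles, which are limits only if `b_min = 0`. -/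
lemma mem_pencilSet_or_pole_of_mem_closure (ha : ∀ j, 0 < a j) (hb : ∀ j, 0 < b j)
    (hinj : Function.Injective b) (hbmin : 0 ≤ bmin) {z : ℂ}
    (hz : z ∈ closure (pencilSet a b bmin bmax W)) :
    z ∈ pencilSet a b bmin bmax W ∨ (bmin = 0 ∧ ∃ i, z = -(b i : ℂ)) := by
  obtain ⟨u, hu, hlim⟩ := mem_closure_iff_seq_limit.1 hz
  choose hD t ht s hs heq using hu
  obtain ⟨p, hp, φ, hφ, hφlim⟩ := (isCompact_Icc.prod isCompact_Icc).tendsto_subseq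
    (x := fun n => (t n, s n)) (s := Icc 0 W⁻¹ ×ˢ Icc bmin bmax) fun n => ⟨ht n, hs n⟩
  have htlim : Tendsto (fun n => ((t (φ n) : ℝ) : ℂ)) atTop (𝓝 (p.1 : ℂ)) :=
    (Complex.continuous_ofReal.tendsto _).comp ((continuous_fst.tendsto _).comp hφlim)
  have hslim : Tendsto (fun n => ((s (φ n) : ℝ) : ℂ)) atTop (𝓝 (p.2 : ℂ)) :=
    (Complex.continuous_ofReal.tendsto _).comp ((continuous_snd.tendsto _).comp hφlim)
  have hulim : Tendsto (fun n => u (φ n)) atTop (𝓝 z) := hlim.comp hφ.tendsto_atTop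
  have hL : Tendsto (fun n => u (φ n) ^ 2 * (t (φ n) : ℂ) + 1) atTop
      (𝓝 (z ^ 2 * (p.1 : ℂ) + 1)) := ((hulim.pow 2).mul htlim).add_const 1
  by_cases hzD : z ∈ symbolDomain b
  · refine .inl ⟨hzD, p.1, hp.1, p.2, hp.2, ?_⟩
    have hR := hslim.mul ((continuousAt_Khat a hzD).tendsto.comp hulim)
    refine tendsto_nhds_unique hL (hR.congr fun n => ?_)
    exact (heq (φ n)).symm
  · simp only [symbolDomain, mem_ofPred_eq, not_forall, not_not, ne_eq] at hzD
    obtain ⟨i, rfl⟩ := hzD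
    refine .inr ⟨?_, i, rfl⟩
    have hK : Tendsto (fun n => ‖Khat a b (u (φ n))‖) atTop atTop :=
      (tendsto_norm_Khat_pole ha hb hinj i).comp
        (tendsto_nhdsWithin_iff.2 ⟨hulim, Eventually.of_forall fun n => hD (φ n) i⟩)
    -- `s` is the bounded quantity `z² t + 1` divided by the unbounded `K̂`, so its limit is `0`,
    -- which must still be at least `bmin`.
    have h0 : Tendsto (fun n => ‖((s (φ n) : ℝ) : ℂ)‖) atTop (𝓝 0) := by
      refine (hL.norm.div_atTop hK).congr' ?_
      filter_upwards [hK.eventually_gt_atTop 0] with n hn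
      rw [heq (φ n), norm_mul, mul_div_cancel_right₀ _ hn.ne']
    have hp2 : ‖((p.2 : ℝ) : ℂ)‖ = 0 := tendsto_nhds_unique hslim.norm h0
    have : p.2 = 0 := by simpa using hp2
    exact le_antisymm (this ▸ hp.2.1) hbmin

/-- Real limit points of the companion set are limit points of the level set. -/
lemma mem_closure_gLevelSet (hN : 0 < N) (ha : ∀ j, 0 < a j)
    (hb : ∀ j, 0 < b j) (hinj : Function.Injective b) (hbmin : 0 ≤ bmin) (hbmax : 0 < bmax)
    (hsum : bmax * ∑ j, a j < 1) (hW : 0 < W) {x : ℝ}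
    (hx : (x : ℂ) ∈ closure (pencilSet a b bmin bmax W)) :
    x ∈ closure (gLevelSet a b bmin bmax W) := by
  rcases mem_pencilSet_or_pole_of_mem_closure ha hb hinj hbmin hx with h | ⟨rfl, i, hi⟩
  · rcases mem_or_eventually_of_ofReal_mem_pencilSet hN ha hb hbmin hbmax hsum hW h with h | h
    · exact subset_closure h
    · exact mem_closure_of_frequently_of_tendsto h.frequently nhdsWithin_le_nhds
  · obtain rfl : x = -b i := by exact_mod_cast hi
    exact mem_closure_of_frequently_of_tendsto
      (eventually_mem_gLevelSet_pole ha hb hinj hbmax hW i).frequently nhdsWithin_le_nhds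

/-- Membership needs `s K̂(x) > 1`. The kernel is nonpositive up to the leftmost pole, and `bmax ∑
aⱼ < 1` keeps the product below `1` for `x ≥ 0`. -/
lemma gLevelSet_subset (ha : ∀ j, 0 < a j) (hb : ∀ j, 0 < b j)
    (hbmin : 0 ≤ bmin) (hbmax : 0 < bmax) (hsum : bmax * ∑ j, a j < 1) (hW : 0 < W)
    {i : Fin N} (hi : ∀ j, b j ≤ b i) :
    gLevelSet a b bmin bmax W ⊆ Ioo (-b i) 0 := by
  intro x hx
  obtain ⟨hD, s, hs, h1, h2⟩ := (mem_gLevelSet_iff hW).1 hx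
  refine ⟨?_, lt_zero_of_one_le ha hb hbmax hsum hs.2 h1.le⟩
  by_contra hlt
  have hk : realKernel a b x ≤ 0 := Finset.sum_nonpos fun j _ => by
    refine div_nonpos_of_nonneg_of_nonpos (mul_pos (ha j) (hb j)).le ?_
    linarith [hi j]
  nlinarith [mul_nonneg (hbmin.trans hs.1) (neg_nonneg.2 hk)]

/-- Between the rightmost pole `-b₀` and `0`, `bmax K̂` falls from `+∞` to below `1`, so it crosses
`1`; points just left of the crossing belong to the set. -/
lemma gLevelSet_nonempty (hN : 0 < N) (ha : ∀ j, 0 < a j) (hb : ∀ j, 0 < b j)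
    (hmono : StrictMono b) (hbmin : 0 ≤ bmin) (hbmax : 0 < bmax) (hle : bmin ≤ bmax)
    (hsum : bmax * ∑ j, a j < 1) (hW : 0 < W) :
    (gLevelSet a b bmin bmax W).Nonempty := by
  have hmin : ∀ j, b ⟨0, hN⟩ ≤ b j := fun j => hmono.monotone (Fin.mk_le_of_le_val (Nat.zero_le _))
  obtain ⟨y, hy1, hy2, hy3⟩ := (((tendsto_realKernel_pole ha hb hmono.injective
    ⟨0, hN⟩).eventually_ge_atTop bmax⁻¹).and (Ioo_mem_nhdsGT (neg_lt_zero.2 (hb ⟨0, hN⟩)))).exists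
  have hcont : ContinuousOn (fun x => bmax * realKernel a b x) (Icc y 0) := fun x hx =>
    (continuousAt_const.mul (continuousAt_realKernel a fun j => by
      have := hx.1
      have := hmin j
      exact ne_of_gt (by linarith))).continuousWithinAt
  have h1 : (1 : ℝ) ∈ Icc (bmax * realKernel a b 0) (bmax * realKernel a b y) := by
    refine ⟨(mul_realKernel_lt_one ha hb hbmax hsum le_rfl le_rfl).le, ?_⟩
    rwa [inv_le_iff_one_le_mul₀' hbmax] at hy1
  obtain ⟨x, hx, hx1⟩ := intermediate_value_Icc' hy3.le hcont h1
  have hx0 := lt_zero_of_one_le ha hb hbmax hsum le_rfl (ge_of_eq hx1)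
  exact (eventually_mem_gLevelSet hN ha hb hbmin (W := W) (bmin := bmin) (bmax := bmax)
    (fun j => by
      have := hx.1
      have := hmin j
      exact ne_of_gt (by linarith)) ⟨hle, le_rfl⟩ hx0.ne hW hx1).exists

/-- For `bmin > 0` no pole is a limit point, so the infimum solves the pencil equation. Were it not
in the set, points of the set would lie to its left. -/
lemma sInf_mem_gLevelSet (hN : 0 < N) (ha : ∀ j, 0 < a j) (hb : ∀ j, 0 < b j)
    (hinj : Function.Injective b) (hbmin : 0 < bmin) (hbmax : 0 < bmax)
    (hsum : bmax * ∑ j, a j < 1) (hW : 0 < W) (hne : (gLevelSet a b bmin bmax W).Nonempty)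
    (hbdd : BddBelow (gLevelSet a b bmin bmax W)) :
    sInf (gLevelSet a b bmin bmax W) ∈ gLevelSet a b bmin bmax W := by
  set c := sInf (gLevelSet a b bmin bmax W)
  have hc : (c : ℂ) ∈ closure (pencilSet a b bmin bmax W) :=
    map_mem_closure Complex.continuous_ofReal (csInf_mem_closure hne hbdd)
      fun x hx => ofReal_mem_pencilSet hW hx
  rcases mem_pencilSet_or_pole_of_mem_closure ha hb hinj hbmin.le hc with h | ⟨h, -⟩
  · rcases mem_or_eventually_of_ofReal_mem_pencilSet hN ha hb hbmin.le hbmax hsum hW h with h | h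
    · exact h
    · obtain ⟨y, hy, hlt⟩ := (h.and self_mem_nhdsWithin).exists
      exact absurd (csInf_le hbdd hy) (not_le.2 hlt)
  · exact absurd h hbmin.ne'

/-! ### Real points of the enclosure -/

/-- If `α` takes arbitrarily large values, the solutions of `r K̂(x) = 1` are limits of real
solutions of `y² + α - r α K̂(y) = 0`. -/
lemma mem_closure_real_solutions (hN : 0 < N) (ha : ∀ j, 0 < a j) (hb : ∀ j, 0 < b j)
    {A : Set ℝ} (hA : ¬ BddAbove A) {r : ℝ} (hr : 0 ≤ r) {x : ℝ} (hD : ∀ j, x ≠ -b j)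
    (h : r * realKernel a b x = 1) :
    x ∈ closure {y : ℝ | (∀ j, y ≠ -b j) ∧ ∃ α ∈ A, 0 < α ∧
      y ^ 2 + α - r * α * realKernel a b y = 0} := by
  have hr0 : 0 < r := lt_of_le_of_ne hr (by rintro rfl; simp at h)
  rw [Metric.mem_closure_iff]
  intro ε hε
  obtain ⟨δ, hδ, hball⟩ := Metric.eventually_nhds_iff.1 (eventually_ne_pole hD)
  obtain ⟨p, hpk, hp1, hp2⟩ := ((eventually_realKernel_gt hN ha hb hD).and
    (Ioo_mem_nhdsLT (sub_lt_self x (lt_min hε hδ)))).exists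
  obtain ⟨q, hqk, hq1, hq2⟩ := ((eventually_realKernel_lt hN ha hb hD).and
    (Ioo_mem_nhdsGT (lt_add_of_pos_right x (lt_min hε hδ)))).exists
  have hclose : ∀ y ∈ Icc p q, dist y x < min ε δ := fun y hy => by
    rw [Real.dist_eq, abs_lt]
    constructor <;> linarith [hy.1, hy.2]
  have hneq : ∀ y ∈ Icc p q, ∀ j, y ≠ -b j := fun y hy =>
    hball ((hclose y hy).trans_le (min_le_right _ _))
  have hp3 : 0 < r * realKernel a b p - 1 := by
    rw [← h]; exact sub_pos.2 (mul_lt_mul_of_pos_left hpk hr0)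
  have hq3 : r * realKernel a b q < 1 := by
    rw [← h]; exact mul_lt_mul_of_pos_left hqk hr0
  -- This threshold makes the function negative at `p`; at `q` it is positive for every `α > 0`.
  obtain ⟨α, hα, hαlt⟩ := not_bddAbove_iff.1 hA (p ^ 2 / (r * realKernel a b p - 1))
  have hα0 : 0 < α := lt_of_le_of_lt (div_nonneg (sq_nonneg p) hp3.le) hαlt
  rw [div_lt_iff₀ hp3] at hαlt
  have hcont : ContinuousOn (fun y => y ^ 2 + α - r * α * realKernel a b y) (Icc p q) :=
    fun y hy => ((((continuousAt_id.pow 2).add continuousAt_const).sub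
      (continuousAt_const.mul (continuousAt_realKernel a (hneq y hy))))).continuousWithinAt
  have h0 : (0 : ℝ) ∈ Icc (p ^ 2 + α - r * α * realKernel a b p)
      (q ^ 2 + α - r * α * realKernel a b q) :=
    ⟨by nlinarith, by nlinarith [sq_nonneg q, mul_pos hα0 (sub_pos.2 hq3)]⟩
  obtain ⟨y, hy, hy0⟩ := intermediate_value_Icc (hp2.trans hq1).le hcont h0
  refine ⟨y, ⟨hneq y hy, α, hα, hα0, hy0⟩, ?_⟩
  rw [dist_comm]
  exact (hclose y hy).trans_le (min_le_left _ _)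

end GurtinPipkin

/-! ### Fredholm theory -/

section Fredholm

variable {E : Type*} [NormedAddCommGroup E] [InnerProductSpace ℂ E]

open LinearMap.FiniteRangeSetoid in
/-- A finite rank perturbation of an invertible operator is Fredholm. -/
lemma ContinuousLinearMap.IsFredholm.of_isUnit_add_finiteRange {U F : E →L[ℂ] E} (hU : IsUnit U)
    (hF : (F : E →ₗ[ℂ] E).HasFiniteRange) : (U + F).IsFredholm := by
  obtain ⟨u, rfl⟩ := hU
  -- Modulo finite rank, `U + F` equals `U`, so the inverse of `U` is a quasi-inverse.
  refine ContinuousLinearMap.IsFredholm.of_isQuasiInverse (v := (↑u⁻¹ : E →L[ℂ] E)) ?_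
  have h : (((u : E →L[ℂ] E) + F : E →L[ℂ] E) : E →ₗ[ℂ] E) ≈ ((u : E →L[ℂ] E) : E →ₗ[ℂ] E) := by
    rw [equiv_iff_hasFiniteRange]
    simpa using hF
  refine LinearMap.IsQuasiInverse.congr ?_ (Setoid.refl _) h
  have h1 : ((↑u⁻¹ : E →L[ℂ] E) : E →ₗ[ℂ] E) ∘ₗ ((u : E →L[ℂ] E) : E →ₗ[ℂ] E) = LinearMap.id := by
    ext x; exact congr($(u.inv_mul) x)
  have h2 : ((u : E →L[ℂ] E) : E →ₗ[ℂ] E) ∘ₗ ((↑u⁻¹ : E →L[ℂ] E) : E →ₗ[ℂ] E) = LinearMap.id := by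
    ext x; exact congr($(u.mul_inv) x)
  constructor
  · rw [LinearMap.IsLeftQuasiInverse, h1]
  · rw [LinearMap.IsRightQuasiInverse, h2]

/-- A compact operator in a Hilbert space is a norm limit of operators of finite rank. -/
lemma IsCompactOperator.exists_finiteRange_norm_sub_le {R : E →L[ℂ] E} (hR : IsCompactOperator R)
    {ε : ℝ} (hε : 0 < ε) :
    ∃ F : E →L[ℂ] E, (F : E →ₗ[ℂ] E).HasFiniteRange ∧ ‖R - F‖ ≤ ε := by
  -- `F` is `R` followed by the projection onto the span of a finite `ε`-net for the image of the
  -- unit ball.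
  obtain ⟨K, hK, hsub⟩ := hR.image_closedBall_subset_compact (𝕜₁ := ℂ) 1
  obtain ⟨t, -, ht, hcov⟩ := hK.finite_cover_balls hε
  set V := Submodule.span ℂ t
  have : FiniteDimensional ℂ V := FiniteDimensional.span_of_finite ℂ ht
  refine ⟨V.starProjection ∘L R, ?_, ?_⟩
  · have h1 : ((V.starProjection : E →L[ℂ] E) : E →ₗ[ℂ] E).HasFiniteRange := by
      rw [LinearMap.HasFiniteRange]
      have : LinearMap.range ((V.starProjection : E →L[ℂ] E) : E →ₗ[ℂ] E) = V := by
        simp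
      rw [this]
      exact Submodule.FG.of_finite
    exact h1.comp_right _
  · refine ContinuousLinearMap.opNorm_le_of_unit_norm hε.le fun x hx => ?_
    have hx' : R x ∈ K := hsub ⟨x, by simp [hx], rfl⟩
    obtain ⟨y, hy, hxy⟩ := mem_iUnion₂.1 (hcov hx')
    have := V.starProjection_minimal (R x)
    simp only [sub_apply, ContinuousLinearMap.comp_apply]
    rw [this]
    refine (ciInf_le ⟨0, ?_⟩ (⟨y, Submodule.subset_span hy⟩ : V)).trans ?_
    · rintro _ ⟨w, rfl⟩; exact norm_nonneg _
    · rw [← dist_eq_norm]; exact (Metric.mem_ball.1 hxy).le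

/-- A compact perturbation of an invertible operator in a Hilbert space is Fredholm. -/
lemma IsCompactOperator.isFredholm_add_smul [CompleteSpace E] {R : E →L[ℂ] E}
    (hR : IsCompactOperator R) {C : E →L[ℂ] E} (hC : IsUnit C) (w : ℂ) :
    (C + w • R).IsFredholm := by
  have hopen : ∀ᶠ U in 𝓝 C, IsUnit U := Units.isOpen.mem_nhds hC
  obtain ⟨δ, hδ, hball⟩ := Metric.eventually_nhds_iff.1 hopen
  have hw : 0 < ‖w‖ + 1 := by positivity
  -- The `+ 1` covers `w = 0` and makes the final estimate strict.
  obtain ⟨F, hF, hle⟩ := hR.exists_finiteRange_norm_sub_le (ε := δ / (‖w‖ + 1)) (by positivity)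
  have hU : IsUnit (C + w • (R - F)) := by
    refine hball ?_
    rw [dist_eq_norm, add_sub_cancel_left, norm_smul]
    calc ‖w‖ * ‖R - F‖ ≤ ‖w‖ * (δ / (‖w‖ + 1)) := by gcongr
      _ < (‖w‖ + 1) * (δ / (‖w‖ + 1)) := by
        have : 0 < δ / (‖w‖ + 1) := by positivity
        gcongr; linarith
      _ = δ := by field_simp
  have := ContinuousLinearMap.IsFredholm.of_isUnit_add_finiteRange hU (F := w • F) (hF.smul w)
  convert this using 1
  rw [smul_sub]; abel

/-- A compact operator that is bounded below lives on a finite-dimensional space. -/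
lemma IsCompactOperator.finiteDimensional_of_antilipschitz [CompleteSpace E] {R : E →L[ℂ] E}
    (hR : IsCompactOperator R) {c : ℝ} (h : ∀ x, ‖x‖ ≤ c * ‖R x‖) : FiniteDimensional ℂ E := by
  obtain ⟨K, hK, hsub⟩ := hR.image_closedBall_subset_compact (𝕜₁ := ℂ) 1
  have hanti : AntilipschitzWith (Real.toNNReal c) R :=
    R.antilipschitz_of_bound fun x => (h x).trans
      (mul_le_mul_of_nonneg_right (Real.le_coe_toNNReal c) (norm_nonneg _))
  -- Preimages of compact sets are compact, so the closed unit ball is compact and Riesz's theorem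
  -- applies.
  have hemb := hanti.isClosedEmbedding R.uniformContinuous
  refine FiniteDimensional.of_isCompact_closedBall ℂ one_pos (c := 0) ?_
  exact (hemb.isCompact_preimage hK).of_isClosed_subset Metric.isClosed_closedBall
    (image_subset_iff.1 hsub)

end Fredholm

namespace GurtinPipkin

/-! ### Unbounded operators whose domain is the range of a bounded inverse -/

section Operators

variable {H : Type*} [NormedAddCommGroup H] [InnerProductSpace ℂ H]

lemma sub_scalarOp_zero (A : H →ₗ.[ℂ] H) : A - scalarOp H 0 = A := by
  refine LinearPMap.ext (by simp [LinearPMap.sub_domain, scalarOp]) fun x y hxy => ?_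
  simp [LinearPMap.sub_apply, scalarOp]

lemma zero_mem_essSpectrum {A : H →ₗ.[ℂ] H} : (0 : ℂ) ∈ essSpectrum A ↔ ¬ IsFredholmOp A := by
  simp [essSpectrum, sub_scalarOp_zero]

lemma isFredholmOp_of_finiteDimensional [FiniteDimensional ℂ H] (A : H →ₗ.[ℂ] H) :
    IsFredholmOp A :=
  ⟨inferInstance, Submodule.closed_of_finiteDimensional _, inferInstance⟩

/-- If `R` is the inverse of `T` and `A R = M` with a bounded operator `M` that is the sum of an
invertible operator and a multiple of `R`, then `A` is closed. -/
lemma isClosed_of_comp_inverse {R C : H →L[ℂ] H} (hC : IsUnit C) {w : ℂ} {A : H →ₗ.[ℂ] H}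
    (hdom : ∀ u, u ∈ A.domain → ∃ x, R x = u)
    (hRA : ∀ x, ∃ h : R x ∈ A.domain, A ⟨R x, h⟩ = (C + w • R) x) : A.IsClosed := by
  obtain ⟨u, rfl⟩ := hC
  -- Solving `q = C x + w p`, `p = R x` for `x` turns the graph into the zero set of a continuous
  -- equation.
  have hgraph : (A.graph : Set (H × H)) =
      {p | R ((↑u⁻¹ : H →L[ℂ] H) (p.2 - w • p.1)) = p.1} := by
    ext ⟨p, q⟩
    simp only [SetLike.mem_coe, mem_ofPred_eq, LinearPMap.mem_graph_iff]
    constructor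
    · rintro ⟨y, rfl, rfl⟩
      obtain ⟨x, hx⟩ := hdom y y.2
      obtain ⟨h, hA⟩ := hRA x
      obtain rfl : y = ⟨R x, h⟩ := Subtype.ext hx.symm
      rw [hA]
      have : (↑u⁻¹ : H →L[ℂ] H) ((u : H →L[ℂ] H) x) = x := congr($(u.inv_mul) x)
      simp [this]
    · intro hp
      set x := (↑u⁻¹ : H →L[ℂ] H) (q - w • p) with hx
      obtain ⟨h, hA⟩ := hRA x
      refine ⟨⟨R x, h⟩, hp, ?_⟩
      have : (u : H →L[ℂ] H) x = q - w • p := congr($(u.mul_inv) (q - w • p))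
      rw [hA]
      simp [this, hp]
  rw [LinearPMap.IsClosed, hgraph]
  exact isClosed_eq (by fun_prop) (by fun_prop)

/-- `R` maps onto the domain of `A`, so `A` and `M` have the same range and `R` carries the kernel
of `M` onto that of `A`. -/
lemma isFredholmOp_of_comp_inverse {R M : H →L[ℂ] H} (hM : M.IsFredholm) {A : H →ₗ.[ℂ] H}
    (hdom : ∀ u, u ∈ A.domain → ∃ x, R x = u)
    (hRA : ∀ x, ∃ h : R x ∈ A.domain, A ⟨R x, h⟩ = M x) : IsFredholmOp A := by
  have hrange : LinearMap.range A.toFun = LinearMap.range (M : H →ₗ[ℂ] H) := by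
    ext q
    constructor
    · rintro ⟨y, rfl⟩
      obtain ⟨x, hx⟩ := hdom y y.2
      obtain ⟨h, hA⟩ := hRA x
      obtain rfl : y = ⟨R x, h⟩ := Subtype.ext hx.symm
      exact ⟨x, hA.symm⟩
    · rintro ⟨x, rfl⟩
      obtain ⟨h, hA⟩ := hRA x
      exact ⟨⟨R x, h⟩, hA⟩
  refine ⟨?_, ?_, ?_⟩
  · have := hM.finite_ker
    let f : LinearMap.ker (M : H →ₗ[ℂ] H) →ₗ[ℂ] LinearMap.ker A.toFun :=
      { toFun := fun x => ⟨⟨R x, (hRA x).1⟩, (hRA x).2.trans x.2⟩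
        map_add' := fun x y => by ext; simp
        map_smul' := fun c x => by ext; simp }
    refine Module.Finite.of_surjective f ?_
    rintro ⟨y, hy⟩
    obtain ⟨x, hx⟩ := hdom y y.2
    obtain ⟨h, hA⟩ := hRA x
    obtain rfl : y = ⟨R x, h⟩ := Subtype.ext hx.symm
    exact ⟨⟨x, hA.symm.trans hy⟩, rfl⟩
  · rw [hrange]; exact hM.isClosed_range
  · rw [hrange]; exact hM.finite_coker

variable {N : ℕ} {a b : Fin N → ℝ}

/-- `T(z)` is Fredholm as soon as `1 - K̂(z) B` is invertible. -/
lemma isFredholmOp_symbolOp [CompleteSpace H] {Ta Tb : H →ₗ.[ℂ] H} (hTa : HasCompactInverse Ta)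
    {B : H →L[ℂ] H} (hB : (B : H →ₗ[ℂ] H).compPMap Ta ≤ Tb) {z : ℂ}
    (hC : IsUnit (1 - Khat a b z • B)) : IsFredholmOp (symbolOp a b Ta Tb z) := by
  obtain ⟨R, hR, hTR, hRT⟩ := hTa
  set A : H →ₗ.[ℂ] H := scalarOp H (z ^ 2) + Ta - Khat a b z • Tb
  have hdom : ∀ u, u ∈ A.domain → ∃ x, R x = u := by
    intro u hu
    have : u ∈ Ta.domain := hu.1.2
    exact ⟨Ta ⟨u, this⟩, hRT ⟨u, this⟩⟩
  have hRA : ∀ x, ∃ h : R x ∈ A.domain,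
      A ⟨R x, h⟩ = ((1 - Khat a b z • B) + z ^ 2 • R) x := by
    intro x
    obtain ⟨h1, h1'⟩ := hTR x
    have h2 : R x ∈ Tb.domain := hB.1 h1
    have h2' : Tb ⟨R x, h2⟩ = B x := by
      have := hB.2 (x := ⟨R x, h1⟩) (y := ⟨R x, h2⟩) rfl
      exact this.symm.trans (congrArg B h1')
    refine ⟨⟨⟨trivial, h1⟩, h2⟩, ?_⟩
    have : A ⟨R x, ⟨⟨trivial, h1⟩, h2⟩⟩ = z ^ 2 • R x + Ta ⟨R x, h1⟩ - Khat a b z • Tb ⟨R x, h2⟩ :=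
      rfl
    rw [this, h1', h2']
    simp
    abel
  have hclosed := isClosed_of_comp_inverse hC hdom hRA
  have : A.closure = A := by
    refine LinearPMap.eq_of_eq_graph ?_
    rw [← hclosed.isClosable.graph_closure_eq_closure_graph]
    exact hclosed.submodule_topologicalClosure_eq
  rw [symbolOp, this]
  exact isFredholmOp_of_comp_inverse (hR.isFredholm_add_smul hC _) hdom hRA

/-! ### The numerical range of an operator with compact inverse -/

lemma isFormalAdjoint_self [CompleteSpace H] {Ta : H →ₗ.[ℂ] H} (hTa : IsSelfAdjoint Ta) :
    Ta.IsFormalAdjoint Ta := by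
  have h := LinearPMap.adjoint_isFormalAdjoint (T := Ta) hTa.dense_domain
  rwa [LinearPMap.isSelfAdjoint_def.1 hTa] at h

/-- The inverse of a positive self-adjoint operator is `Q²` with a self-adjoint `Q`. -/
lemma exists_sqrt_inverse [CompleteSpace H] {Ta : H →ₗ.[ℂ] H} (hTa : IsSelfAdjoint Ta)
    (hpos : IsPositiveOp Ta) {R : H →L[ℂ] H} (hTR : ∀ x : H, ∃ h : R x ∈ Ta.domain, Ta ⟨R x, h⟩ = x) :
    ∃ Q : H →L[ℂ] H, IsSelfAdjoint Q ∧ R = Q * Q := by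
  have hsymm := isFormalAdjoint_self hTa
  have hRpos : R.IsPositive := by
    refine ⟨fun x y => ?_, fun x => ?_⟩
    · obtain ⟨h1, h1'⟩ := hTR x
      obtain ⟨h2, h2'⟩ := hTR y
      have := hsymm ⟨R x, h1⟩ ⟨R y, h2⟩
      rw [h1', h2'] at this
      exact this.symm
    · obtain ⟨h1, h1'⟩ := hTR x
      rw [ContinuousLinearMap.reApplyInnerSelf_apply]
      by_cases h0 : R x = 0
      · simp [h0]
      · have := hpos ⟨R x, h1⟩ h0
        rw [h1'] at this
        exact this.le
  have hR0 : 0 ≤ R := (ContinuousLinearMap.nonneg_iff_isPositive R).2 hRpos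
  exact ⟨CFC.sqrt R, (CFC.sqrt_nonneg R).isSelfAdjoint, (CFC.sqrt_mul_sqrt_self R hR0).symm⟩

/-- The Rayleigh quotients of a symmetric operator lie in its numerical range. -/
lemma rayleigh_mem_numRange {Ta : H →ₗ.[ℂ] H} (hTa : Ta.IsFormalAdjoint Ta) (v : Ta.domain)
    (hv : (v : H) ≠ 0) : (inner ℂ (v : H) (Ta v)).re / ‖(v : H)‖ ^ 2 ∈ numRange Ta := by
  have hreal : inner ℂ (v : H) (Ta v) = ((inner ℂ (v : H) (Ta v)).re : ℂ) := by
    refine (Complex.conj_eq_iff_re.1 ?_).symm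
    rw [inner_conj_symm]
    exact hTa v v
  have hn : ‖(v : H)‖ ≠ 0 := norm_ne_zero_iff.2 hv
  refine ⟨((‖(v : H)‖⁻¹ : ℝ) : ℂ) • v, ?_, ?_⟩
  · simp [norm_smul, hn]
  · rw [LinearPMap.map_smul, Submodule.coe_smul, inner_smul_left, inner_smul_right, hreal,
      Complex.conj_ofReal]
    norm_cast
    field_simp

lemma numRange_nonempty [Nontrivial H] {Ta : H →ₗ.[ℂ] H} (hinv : HasCompactInverse Ta)
    (hTa : Ta.IsFormalAdjoint Ta) : (numRange Ta).Nonempty := by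
  obtain ⟨R, -, hTR, -⟩ := hinv
  obtain ⟨x, hx⟩ := exists_ne (0 : H)
  obtain ⟨h, hT⟩ := hTR x
  refine ⟨_, rayleigh_mem_numRange hTa ⟨R x, h⟩ fun h0 => hx ?_⟩
  rw [← hT, ← Ta.map_zero]
  exact congrArg Ta (Subtype.ext h0)

/-- For `Q² = Ta⁻¹` this makes the Rayleigh quotient of `Ta` at `Q² x` equal to `‖Q x‖² / ‖Q² x‖²`.
-/
lemma inner_sqrt_eq [CompleteSpace H] {Q : H →L[ℂ] H} (hQ : IsSelfAdjoint Q) (x : H) :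
    inner ℂ ((Q * Q) x) x = (((‖Q x‖ ^ 2 : ℝ)) : ℂ) := by
  have h := ContinuousLinearMap.adjoint_inner_right Q (Q x) x
  rw [ContinuousLinearMap.isSelfAdjoint_iff'.1 hQ] at h
  have h2 : inner ℂ ((Q * Q) x) x = inner ℂ (Q x) (Q x) := h.symm
  rw [h2, inner_self_eq_norm_sq_to_K]
  norm_cast

/-- For a unit vector `u = Q² y`, `1 ≤ ‖Q‖ ‖Q y‖`, while `α = ‖Q y‖²`. -/
lemma exists_pos_forall_numRange_ge [CompleteSpace H] {Ta : H →ₗ.[ℂ] H} (hTa : IsSelfAdjoint Ta)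
    (hpos : IsPositiveOp Ta) (hinv : HasCompactInverse Ta) :
    ∃ δ > 0, ∀ α ∈ numRange Ta, δ ≤ α := by
  obtain ⟨R, -, hTR, hRT⟩ := hinv
  obtain ⟨Q, hQ, rfl⟩ := exists_sqrt_inverse hTa hpos hTR
  refine ⟨(‖Q‖ ^ 2 + 1)⁻¹, by positivity, ?_⟩
  rintro α ⟨u, hu, hα⟩
  rw [← hRT u, inner_sqrt_eq hQ, Complex.ofReal_inj] at hα
  have h1 : 1 ≤ ‖Q‖ * ‖Q (Ta u)‖ := by
    rw [← hu, ← hRT u]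
    exact Q.le_opNorm _
  rw [inv_le_iff_one_le_mul₀' (by positivity), ← hα]
  nlinarith [sq_nonneg ‖Q (Ta u)‖]

lemma numRangeMin_pos [CompleteSpace H] [Nontrivial H] {Ta : H →ₗ.[ℂ] H} (hTa : IsSelfAdjoint Ta)
    (hpos : IsPositiveOp Ta) (hinv : HasCompactInverse Ta) : 0 < numRangeMin Ta := by
  obtain ⟨δ, hδ, h⟩ := exists_pos_forall_numRange_ge hTa hpos hinv
  exact hδ.trans_le (le_csInf (numRange_nonempty hinv (isFormalAdjoint_self hTa)) h)

lemma numRangeMin_le [CompleteSpace H] {Ta : H →ₗ.[ℂ] H} (hTa : IsSelfAdjoint Ta)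
    (hpos : IsPositiveOp Ta) (hinv : HasCompactInverse Ta) {α : ℝ} (hα : α ∈ numRange Ta) :
    numRangeMin Ta ≤ α := by
  obtain ⟨δ, -, h⟩ := exists_pos_forall_numRange_ge hTa hpos hinv
  exact csInf_le ⟨δ, h⟩ hα

/-- An operator with compact inverse and bounded numerical range acts in a space of finite
dimension. -/
lemma finiteDimensional_of_bddAbove_numRange [CompleteSpace H] {Ta : H →ₗ.[ℂ] H}
    (hTa : IsSelfAdjoint Ta) (hpos : IsPositiveOp Ta) (hinv : HasCompactInverse Ta)
    (hbdd : BddAbove (numRange Ta)) : FiniteDimensional ℂ H := by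
  obtain ⟨R, hR, hTR, hRT⟩ := hinv
  obtain ⟨Q, hQ, rfl⟩ := exists_sqrt_inverse hTa hpos hTR
  obtain ⟨C₀, hC₀⟩ := hbdd
  set C := max C₀ 0
  -- Bounded Rayleigh quotients bound `Q` from below on its range, which is dense as `Q` is
  -- self-adjoint and injective. Two applications bound `R = Q²` from below.
  have hC : ∀ x, ‖Q x‖ ^ 2 ≤ C * ‖Q (Q x)‖ ^ 2 := by
    intro x
    obtain ⟨h, hT⟩ := hTR x
    have hin : inner ℂ ((Q * Q) x) x = (((‖Q x‖ ^ 2 : ℝ)) : ℂ) := inner_sqrt_eq hQ x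
    by_cases h0 : (Q * Q) x = 0
    · rw [h0, inner_zero_left] at hin
      have : ‖Q x‖ ^ 2 = 0 := by exact_mod_cast hin.symm
      rw [this]
      positivity
    · have hmem := hC₀ (rayleigh_mem_numRange (isFormalAdjoint_self hTa) ⟨(Q * Q) x, h⟩ h0)
      rw [hT, hin, Complex.ofReal_re] at hmem
      have hn : 0 < ‖(Q * Q) x‖ ^ 2 := by positivity
      exact (div_le_iff₀ hn).1 (hmem.trans (le_max_left _ _))
  have hinj : LinearMap.ker (Q : H →ₗ[ℂ] H) = ⊥ := by
    refine (Submodule.eq_bot_iff _).2 fun x hx => ?_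
    have hx : Q x = 0 := hx
    obtain ⟨h, hT⟩ := hTR x
    rw [← hT, ← Ta.map_zero]
    exact congrArg Ta (Subtype.ext (by simp [hx]))
  have hdense : DenseRange Q := by
    have horth := ContinuousLinearMap.orthogonal_range Q
    rw [ContinuousLinearMap.isSelfAdjoint_iff'.1 hQ, hinj,
      ← Submodule.topologicalClosure_eq_top_iff] at horth
    exact Submodule.dense_iff_topologicalClosure_eq_top.2 horth
  have hall : ∀ y, ‖y‖ ^ 2 ≤ C * ‖Q y‖ ^ 2 := fun y =>
    hdense.induction_on (p := fun y => ‖y‖ ^ 2 ≤ C * ‖Q y‖ ^ 2) y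
      (isClosed_le (by fun_prop) (by fun_prop)) hC
  have hC0 : 0 ≤ C := le_max_right _ _
  refine hR.finiteDimensional_of_antilipschitz (c := C) fun y => ?_
  refine le_of_sq_le_sq ?_ (by positivity)
  calc ‖y‖ ^ 2 ≤ C * ‖Q y‖ ^ 2 := hall y
    _ ≤ C * (C * ‖Q (Q y)‖ ^ 2) := by gcongr; exact hC y
    _ = (C * ‖(Q * Q) y‖) ^ 2 := by
      rw [mul_pow, sq C, mul_assoc]; rfl

end Operators

end GurtinPipkin

/-! ### The two inclusions for the enclosure -/

namespace GurtinPipkin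

section Inclusions

variable {H : Type*} [NormedAddCommGroup H] [InnerProductSpace ℂ H]
  {N : ℕ} {a b : Fin N → ℝ} {bmin bmax : ℝ}

/-- A function with values in `[b_min, b_max]` acts with spectrum in `[b_min, b_max]`. -/
lemma isUnit_one_sub_smul [CompleteSpace H] {X : Type*} [TopologicalSpace X] [CompactSpace X]
    (ρ : C(X, ℝ) →⋆ₐ[ℝ] (H →L[ℂ] H)) (β : C(X, ℝ)) (hβ : ∀ x, bmin ≤ β x ∧ β x ≤ bmax) {κ : ℂ}
    (hκ : ∀ r ∈ Icc bmin bmax, (r : ℂ) * κ ≠ 1) : IsUnit (1 - κ • ρ β) := by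
  by_cases h0 : κ = 0
  · simp [h0]
  by_contra hnu
  have hspec : κ⁻¹ ∈ spectrum ℂ (ρ β) := by
    rw [spectrum.mem_iff]
    intro hu
    apply hnu
    have : 1 - κ • ρ β = κ • (algebraMap ℂ (H →L[ℂ] H) κ⁻¹ - ρ β) := by
      rw [smul_sub, Algebra.algebraMap_eq_smul_one, smul_inv_smul₀ h0]
    rw [this]
    exact (isUnit_smul_iff (Units.mk0 κ h0) _).2 hu
  have hsa : IsSelfAdjoint (ρ β) := (IsSelfAdjoint.all β).map ρ
  have hre := hsa.mem_spectrum_eq_re hspec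
  set r := (κ⁻¹).re
  have hr : (r : ℂ) * κ = 1 := by rw [← hre, inv_mul_cancel₀ h0]
  -- If `r` is not a value of `β`, then `r - β` is invertible already as a function, and `ρ`
  -- preserves units.
  have hunit : IsUnit (algebraMap ℝ C(X, ℝ) r - β) := by
    rw [ContinuousMap.isUnit_iff_forall_ne_zero]
    intro x hx
    have : r = β x := sub_eq_zero.1 hx
    exact hκ r (this ▸ hβ x) hr
  have := hunit.map ρ
  rw [map_sub, AlgHomClass.commutes] at this
  rw [spectrum.mem_iff, hre] at hspec
  exact hspec this

lemma enclosure_subset_closure_pencilSet {Ta : H →ₗ.[ℂ] H} (hW : 0 < numRangeMin Ta)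
    (hle : ∀ α ∈ numRange Ta, numRangeMin Ta ≤ α) :
    enclosure a b bmin bmax Ta ⊆ closure (pencilSet a b bmin bmax (numRangeMin Ta)) := by
  refine closure_mono ?_
  rintro z ⟨hD, α, hα, β, hβ, h⟩
  have hα0 : 0 < α := hW.trans_le (hle α hα)
  refine ⟨hD, α⁻¹, ⟨(inv_pos.2 hα0).le, inv_anti₀ hW (hle α hα)⟩, β / α,
    ⟨(le_div_iff₀ hα0).2 hβ.1, (div_le_iff₀ hα0).2 hβ.2⟩, ?_⟩
  have hne : (α : ℂ) ≠ 0 := by exact_mod_cast hα0.ne'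
  push_cast
  field_simp
  linear_combination h

lemma conj_mem_enclosure {Ta : H →ₗ.[ℂ] H} {z : ℂ} (hz : z ∈ enclosure a b bmin bmax Ta) :
    (starRingEnd ℂ) z ∈ enclosure a b bmin bmax Ta := by
  refine map_mem_closure Complex.continuous_conj hz ?_
  rintro z ⟨hD, α, hα, β, hβ, h⟩
  refine ⟨fun j hj => hD j ?_, α, hα, β, hβ, ?_⟩
  · have := congrArg (starRingEnd ℂ) hj
    simpa using this
  · rw [Khat_conj]
    have := congrArg (starRingEnd ℂ) h
    simpa using this

/-- Points where `T(z)` is not Fredholm are real points of the enclosure. -/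
lemma essSpectrumSymbol_subset [CompleteSpace H] (hN : 0 < N) (ha : ∀ j, 0 < a j) (hb : ∀ j, 0 < b j)
    {Ta Tb : H →ₗ.[ℂ] H} (hTa : IsSelfAdjoint Ta) (hpos : IsPositiveOp Ta)
    (hinv : HasCompactInverse Ta) {X : Type*} [TopologicalSpace X] [CompactSpace X]
    (ρ : C(X, ℝ) →⋆ₐ[ℝ] (H →L[ℂ] H)) (β : C(X, ℝ)) (hbmin : 0 ≤ bmin)
    (hβ : ∀ x, bmin ≤ β x ∧ β x ≤ bmax)
    (hTab : ((ρ β : H →L[ℂ] H) : H →ₗ[ℂ] H).compPMap Ta ≤ Tb) :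
    essSpectrumSymbol a b Ta Tb ⊆ enclosure a b bmin bmax Ta ∩ range Complex.ofReal := by
  rintro z ⟨hD, hess⟩
  rw [zero_mem_essSpectrum] at hess
  -- A bounded numerical range would make `H` finite dimensional, where every operator is Fredholm.
  have hA : ¬ BddAbove (numRange Ta) := fun h =>
    have := finiteDimensional_of_bddAbove_numRange hTa hpos hinv h
    hess (isFredholmOp_of_finiteDimensional _)
  obtain ⟨r, hr, hrK⟩ : ∃ r ∈ Icc bmin bmax, (r : ℂ) * Khat a b z = 1 := by
    by_contra! hcon
    exact hess (isFredholmOp_symbolOp hinv hTab (isUnit_one_sub_smul ρ β hβ hcon))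
  have hr0 : r ≠ 0 := by rintro rfl; simp at hrK
  have him : (Khat a b z).im = 0 := by
    have := congrArg Complex.im hrK
    simpa [hr0] using this
  have hz := im_eq_zero_of_Khat_im_eq_zero hN ha hb hD him
  obtain ⟨x, rfl⟩ : ∃ x : ℝ, (x : ℂ) = z := ⟨z.re, Complex.ext rfl (by simp [hz])⟩
  rw [Khat_ofReal] at hrK
  refine ⟨?_, x, rfl⟩
  refine map_mem_closure Complex.continuous_ofReal (mem_closure_real_solutions hN ha hb hA
    (hbmin.trans hr.1) (ofReal_mem_symbolDomain.1 hD) (by exact_mod_cast hrK)) ?_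
  rintro y ⟨hy, α, hα, hα0, h⟩
  refine ⟨ofReal_mem_symbolDomain.2 hy, α, hα, r * α,
    ⟨mul_le_mul_of_nonneg_right hr.1 hα0.le, mul_le_mul_of_nonneg_right hr.2 hα0.le⟩, ?_⟩
  rw [Khat_ofReal]
  exact_mod_cast h

end Inclusions

end GurtinPipkin

end

theorem lemma2p3
    -- the Hilbert space, and a bounded domain
    {H : Type*} [NormedAddCommGroup H] [InnerProductSpace ℂ H] [CompleteSpace H]
    [TopologicalSpace.SeparableSpace H] [Nontrivial H]
    {n : ℕ} (Ω : Set (EuclideanSpace ℝ (Fin n)))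
    (hΩ_open : IsOpen Ω) (hΩ_conn : IsConnected Ω) (hΩ_bdd : Bornology.IsBounded Ω)
    -- how real continuous functions on the closure of the domain act on the Hilbert space
    (ρ : C(closure Ω, ℝ) →⋆ₐ[ℝ] (H →L[ℂ] H))
    -- the kernel
    {N : ℕ} (hN : 0 < N) (a b : Fin N → ℝ)
    (ha : ∀ j, 0 < a j) (hb : ∀ j, 0 < b j) (hb_mono : StrictMono b)
    -- the two operators, `T_b = β T_a` with a continuous function `β`
    (Ta Tb : H →ₗ.[ℂ] H) (hTa : IsSelfAdjoint Ta) (hTa_pos : GurtinPipkin.IsPositiveOp Ta)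
    (hTa_inv : GurtinPipkin.HasCompactInverse Ta)
    (β : C(closure Ω, ℝ)) (hTb : IsSelfAdjoint Tb)
    (hTab : ((ρ β : H →L[ℂ] H) : H →ₗ[ℂ] H).compPMap Ta ≤ Tb)
    (bmin bmax : ℝ) (hbmin : 0 ≤ bmin) (hbmax : 0 < bmax)
    (hβ : ∀ x, bmin ≤ β x ∧ β x ≤ bmax) (hsum : bmax * ∑ j, a j < 1) :
    IsGLB (GurtinPipkin.gSet a b bmin bmax Ta) (GurtinPipkin.c0 a b bmin bmax Ta) ∧
      IsLUB (GurtinPipkin.gSet a b bmin bmax Ta) (GurtinPipkin.c1 a b bmin bmax Ta) ∧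
      GurtinPipkin.essSpectrumSymbol a b Ta Tb ⊆
        GurtinPipkin.enclosure a b bmin bmax Ta ∩ Set.range Complex.ofReal ∧
      GurtinPipkin.enclosure a b bmin bmax Ta ∩ Set.range Complex.ofReal ⊆
        Complex.ofReal '' Set.Icc (GurtinPipkin.c0 a b bmin bmax Ta) (GurtinPipkin.c1 a b bmin bmax Ta) ∧
      Set.Icc (GurtinPipkin.c0 a b bmin bmax Ta) (GurtinPipkin.c1 a b bmin bmax Ta) ⊆
        Set.Icc (-b ⟨N - 1, Nat.sub_one_lt_of_lt hN⟩) 0 ∧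
      (0 < bmin →
        GurtinPipkin.c0 a b bmin bmax Ta ∈ GurtinPipkin.gSet a b bmin bmax Ta ∧
        Set.Icc (GurtinPipkin.c0 a b bmin bmax Ta) (GurtinPipkin.c1 a b bmin bmax Ta) ⊆
          Set.Ioc (-b ⟨N - 1, Nat.sub_one_lt_of_lt hN⟩) 0) ∧
      (∀ z ∈ GurtinPipkin.enclosure a b bmin bmax Ta, (starRingEnd ℂ) z ∈ GurtinPipkin.enclosure a b bmin bmax Ta) := by
  have hcpt : IsCompact (closure Ω) := hΩ_bdd.isCompact_closure
  have : CompactSpace (closure Ω) := isCompact_iff_compactSpace.1 hcpt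
  -- A point of the domain is needed to get `bmin ≤ bmax`.
  obtain ⟨ω, hω⟩ := hΩ_conn.nonempty
  have hle : bmin ≤ bmax := (hβ ⟨ω, subset_closure hω⟩).1.trans (hβ ⟨ω, subset_closure hω⟩).2
  have hW := GurtinPipkin.numRangeMin_pos hTa hTa_pos hTa_inv
  set i : Fin N := ⟨N - 1, Nat.sub_one_lt_of_lt hN⟩
  have hi : ∀ j, b j ≤ b i := fun j => hb_mono.monotone (Fin.mk_le_mk.2 (Nat.le_sub_one_of_lt j.2))
  -- `gSet` is definitionally `gLevelSet` at `W = numRangeMin Ta`.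
  have hne : (GurtinPipkin.gSet a b bmin bmax Ta).Nonempty :=
    GurtinPipkin.gLevelSet_nonempty hN ha hb hb_mono hbmin hbmax hle hsum hW
  have hsub : GurtinPipkin.gSet a b bmin bmax Ta ⊆ Set.Ioo (-b i) 0 :=
    GurtinPipkin.gLevelSet_subset ha hb hbmin hbmax hsum hW hi
  have hbelow : BddBelow (GurtinPipkin.gSet a b bmin bmax Ta) := ⟨-b i, fun x hx => (hsub hx).1.le⟩
  have habove : BddAbove (GurtinPipkin.gSet a b bmin bmax Ta) := ⟨0, fun x hx => (hsub hx).2.le⟩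
  have hglb : IsGLB (GurtinPipkin.gSet a b bmin bmax Ta) (GurtinPipkin.c0 a b bmin bmax Ta) :=
    isGLB_csInf hne hbelow
  have hlub : IsLUB (GurtinPipkin.gSet a b bmin bmax Ta) (GurtinPipkin.c1 a b bmin bmax Ta) :=
    isLUB_csSup hne habove
  have hc0 : -b i ≤ GurtinPipkin.c0 a b bmin bmax Ta := le_csInf hne fun x hx => (hsub hx).1.le
  have hc1 : GurtinPipkin.c1 a b bmin bmax Ta ≤ 0 := csSup_le hne fun x hx => (hsub hx).2.le
  refine ⟨hglb, hlub, GurtinPipkin.essSpectrumSymbol_subset hN ha hb hTa hTa_pos hTa_inv ρ β hbmin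
    hβ hTab, ?_, Set.Icc_subset_Icc hc0 hc1, fun hbmin_pos => ?_,
    fun z hz => GurtinPipkin.conj_mem_enclosure hz⟩
  · rintro _ ⟨hz, x, rfl⟩
    have hx := GurtinPipkin.mem_closure_gLevelSet hN ha hb hb_mono.injective hbmin hbmax hsum hW
      (GurtinPipkin.enclosure_subset_closure_pencilSet hW
        (fun α hα => GurtinPipkin.numRangeMin_le hTa hTa_pos hTa_inv hα) hz)
    refine ⟨x, closure_minimal (fun y hy => ?_) isClosed_Icc hx, rfl⟩
    exact ⟨hglb.1 hy, hlub.1 hy⟩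
  · have hmem : GurtinPipkin.c0 a b bmin bmax Ta ∈ GurtinPipkin.gSet a b bmin bmax Ta :=
      GurtinPipkin.sInf_mem_gLevelSet hN ha hb hb_mono.injective hbmin_pos hbmax hsum hW hne hbelow
    exact ⟨hmem, fun x hx => ⟨(hsub hmem).1.trans_le hx.1, hx.2.trans hc1⟩⟩
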